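/- Formulas are built from a set of atoms by $\top,\bot,\wedge,\vee,\to,\Box$, with $\neg\phi:=\phi\to\bot$; $V(\phi)$ is the set of atoms occurring in $\phi$, and $\phi$ is \emph{monotone} if no implication (hence no negation) occurs in it. A sequent $\Gamma\Rightarrow\Delta$ consists of two finite sequences of formulas, and $\Box\Gamma$ denotes $\Gamma$ with $\Box$ prefixed to each member. Let $\mathbf{LK}$ be the classical propositional sequent calculus with cut, over this language, and consider the modal rules $$(K)\ \frac{\Gamma\Rightarrow\phi}{\Box\Gamma\Rightarrow\Box\phi}\qquad (D)\ \frac{\Gamma\Rightarrow\Delta}{\Box\Gamma\Rightarrow\Box\Delta}\qquad (K4)\ \frac{\Box\Gamma,\Gamma\Rightarrow\phi}{\Box\Gamma\Rightarrow\Box\phi}\qquad (KD4)\ \frac{\Box\Gamma,\Gamma\Rightarrow\Delta}{\Box\Gamma\Rightarrow\Box\Delta}$$ $$(LS4)\ \frac{\Gamma,\phi\Rightarrow\Delta}{\Gamma,\Box\phi\Rightarrow\Delta}\qquad (RS4)\ \frac{\Box\Gamma\Rightarrow\phi}{\Box\Gamma\Rightarrow\Box\phi}\qquad (GL)\ \frac{\Box\Gamma,\Gamma,\Box\phi\Rightarrow\phi}{\Box\Gamma\Rightarrow\Box\phi}$$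 where in $(D)$ and $(KD4)$ the sequence $\Delta$ has at most one member. Let $L$ be one of the logics $\mathsf{K}$, $\mathsf{D}$, $\mathsf{KT}$, $\mathsf{K4}$, $\mathsf{KD4}$, $\mathsf{S4}$, $\mathsf{GL}$, that is, the set of formulas $\phi$ such that $\Rightarrow\phi$ is provable in, respectively, $\mathbf{LK}+(K)$, $\mathbf{LK}+(D)$, $\mathbf{LK}+(K)+(LS4)$, $\mathbf{LK}+(K4)$, $\mathbf{LK}+(KD4)$, $\mathbf{LK}+(LS4)+(RS4)$, $\mathbf{LK}+(GL)$. \textbf{Theorem.} $L$ has the modal disjunctive interpolation property and the monotone modal disjunctive interpolation property: \begin{enumerate} \item for all formulas $\phi,\psi,\theta$ with $(\phi\to\Box\psi\vee\Box\theta)\in L$ there are formulas $I,J$ with $V(I)\subseteq V(\phi)$ and $V(J)\subseteq V(\phi)$ such that $\phi\to(I\vee J)$, $I\to\Box\psi$ and $J\to\Box\theta$ all belong to $L$; \item if moreover $\phi$ is monotone, then there are such $I$ and $J$ that are both monotone. \end{enumerate} -/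

import Mathlib

namespace ModalDI

/-- Formulas of the modal language `{⊤, ⊥, ∧, ∨, →, □}` over atoms from `α`. -/
inductive Formula (α : Type*) where
  | atom : α → Formula α
  | top : Formula α
  | bot : Formula α
  | and : Formula α → Formula α → Formula α
  | or : Formula α → Formula α → Formula α
  | imp : Formula α → Formula α → Formula α
  | box : Formula α → Formula α

namespace Formula

/-- The set of atoms occurring in a formula. -/
def vars {α : Type*} : Formula α → Set α
  | atom p => {p}
  | top => ∅
  | bot => ∅
  | and φ ψ => vars φ ∪ vars ψ
  | or φ ψ => vars φ ∪ vars ψ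
  | imp φ ψ => vars φ ∪ vars ψ
  | box φ => vars φ

/-- A formula is monotone if no implication occurs in it (negation is `φ → ⊥`). -/
def Monotone {α : Type*} : Formula α → Prop
  | atom _ => True
  | top => True
  | bot => True
  | and φ ψ => Monotone φ ∧ Monotone ψ
  | or φ ψ => Monotone φ ∧ Monotone ψ
  | imp _ _ => False
  | box φ => Monotone φ

end Formula

/-- `□Γ`, the sequence obtained by putting a box in front of every member of `Γ`. -/
def boxes {α : Type*} (Γ : List (Formula α)) : List (Formula α) := Γ.map Formula.box

/-- Names of the modal sequent rules. -/
inductive ModalRule where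
  | K | D | K4 | KD4 | LS4 | RS4 | GL

/-- `Provable R Γ Δ`: the sequent `Γ ⇒ Δ` has a proof in the classical sequent calculus `LK`
(with cut, over the modal language) extended by the modal rules in `R`. -/
inductive Provable {α : Type*} (R : Set ModalRule) :
    List (Formula α) → List (Formula α) → Prop where
  -- axioms
  | ax (φ : Formula α) : Provable R [φ] [φ]
  | botL : Provable R [Formula.bot] []
  | topR : Provable R [] [Formula.top]
  -- structural rules and cut
  | exchL (Γ Ξ Δ : List (Formula α)) (φ ψ : Formula α) :
      Provable R (Γ ++ [φ, ψ] ++ Ξ) Δ → Provable R (Γ ++ [ψ, φ] ++ Ξ) Δ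
  | exchR (Γ Δ Λ : List (Formula α)) (φ ψ : Formula α) :
      Provable R Γ (Δ ++ [φ, ψ] ++ Λ) → Provable R Γ (Δ ++ [ψ, φ] ++ Λ)
  | cut (Γ Δ : List (Formula α)) (φ : Formula α) :
      Provable R Γ (φ :: Δ) → Provable R (Γ ++ [φ]) Δ → Provable R Γ Δ
  | weakL (Γ Δ : List (Formula α)) (φ : Formula α) :
      Provable R Γ Δ → Provable R (Γ ++ [φ]) Δ
  | weakR (Γ Δ : List (Formula α)) (φ : Formula α) :
      Provable R Γ Δ → Provable R Γ (φ :: Δ)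
  | contrL (Γ Δ : List (Formula α)) (φ : Formula α) :
      Provable R (Γ ++ [φ, φ]) Δ → Provable R (Γ ++ [φ]) Δ
  | contrR (Γ Δ : List (Formula α)) (φ : Formula α) :
      Provable R Γ (φ :: φ :: Δ) → Provable R Γ (φ :: Δ)
  -- propositional rules
  | andL₁ (Γ Δ : List (Formula α)) (φ ψ : Formula α) :
      Provable R (Γ ++ [φ]) Δ → Provable R (Γ ++ [φ.and ψ]) Δ
  | andL₂ (Γ Δ : List (Formula α)) (φ ψ : Formula α) :
      Provable R (Γ ++ [ψ]) Δ → Provable R (Γ ++ [φ.and ψ]) Δ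
  | andR (Γ Δ : List (Formula α)) (φ ψ : Formula α) :
      Provable R Γ (φ :: Δ) → Provable R Γ (ψ :: Δ) → Provable R Γ (φ.and ψ :: Δ)
  | orL (Γ Δ : List (Formula α)) (φ ψ : Formula α) :
      Provable R (Γ ++ [φ]) Δ → Provable R (Γ ++ [ψ]) Δ → Provable R (Γ ++ [φ.or ψ]) Δ
  | orR₁ (Γ Δ : List (Formula α)) (φ ψ : Formula α) :
      Provable R Γ (φ :: Δ) → Provable R Γ (φ.or ψ :: Δ)
  | orR₂ (Γ Δ : List (Formula α)) (φ ψ : Formula α) :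
      Provable R Γ (ψ :: Δ) → Provable R Γ (φ.or ψ :: Δ)
  | impL (Γ Δ : List (Formula α)) (φ ψ : Formula α) :
      Provable R Γ (φ :: Δ) → Provable R (Γ ++ [ψ]) Δ → Provable R (Γ ++ [φ.imp ψ]) Δ
  | impR (Γ Δ : List (Formula α)) (φ ψ : Formula α) :
      Provable R (Γ ++ [φ]) (ψ :: Δ) → Provable R Γ (φ.imp ψ :: Δ)
  -- modal rules
  | ruleK (Γ : List (Formula α)) (φ : Formula α) : ModalRule.K ∈ R →
      Provable R Γ [φ] → Provable R (boxes Γ) [φ.box]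
  | ruleD (Γ Δ : List (Formula α)) : ModalRule.D ∈ R → Δ.length ≤ 1 →
      Provable R Γ Δ → Provable R (boxes Γ) (boxes Δ)
  | ruleK4 (Γ : List (Formula α)) (φ : Formula α) : ModalRule.K4 ∈ R →
      Provable R (boxes Γ ++ Γ) [φ] → Provable R (boxes Γ) [φ.box]
  | ruleKD4 (Γ Δ : List (Formula α)) : ModalRule.KD4 ∈ R → Δ.length ≤ 1 →
      Provable R (boxes Γ ++ Γ) Δ → Provable R (boxes Γ) (boxes Δ)
  | ruleLS4 (Γ Δ : List (Formula α)) (φ : Formula α) : ModalRule.LS4 ∈ R →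
      Provable R (Γ ++ [φ]) Δ → Provable R (Γ ++ [φ.box]) Δ
  | ruleRS4 (Γ : List (Formula α)) (φ : Formula α) : ModalRule.RS4 ∈ R →
      Provable R (boxes Γ) [φ] → Provable R (boxes Γ) [φ.box]
  | ruleGL (Γ : List (Formula α)) (φ : Formula α) : ModalRule.GL ∈ R →
      Provable R (boxes Γ ++ Γ ++ [φ.box]) [φ] → Provable R (boxes Γ) [φ.box]

/-- The seven modal sequent calculi. -/
inductive Calculus where
  | K | D | KT | K4 | KD4 | S4 | GL

namespace Calculus

/-- The modal rules that a calculus adds to `LK`. -/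
def rules : Calculus → Set ModalRule
  | K => {ModalRule.K}
  | D => {ModalRule.D}
  | KT => {ModalRule.K, ModalRule.LS4}
  | K4 => {ModalRule.K4}
  | KD4 => {ModalRule.KD4}
  | S4 => {ModalRule.LS4, ModalRule.RS4}
  | GL => {ModalRule.GL}

/-- The logic of a calculus: the set of formulas `φ` such that `⇒ φ` is provable. -/
def logic (G : Calculus) (α : Type*) : Set (Formula α) :=
  {φ | Provable G.rules [] [φ]}

end Calculus

/-- `(I, J)` is an `L`-modal disjunctive interpolant for `φ → □ψ ∨ □θ`. -/
structure IsMDI {α : Type*} (L : Set (Formula α)) (φ ψ θ I J : Formula α) : Prop where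
  vars_left : I.vars ⊆ φ.vars
  vars_right : J.vars ⊆ φ.vars
  imp_or : φ.imp (I.or J) ∈ L
  left : I.imp ψ.box ∈ L
  right : J.imp θ.box ∈ L

/-- `(I, J)` is an `L`-monotone modal disjunctive interpolant for `φ → □ψ ∨ □θ`. -/
structure IsMonotoneMDI {α : Type*} (L : Set (Formula α)) (φ ψ θ I J : Formula α) : Prop
    extends IsMDI L φ ψ θ I J where
  monotone : φ.Monotone
  monotone_left : I.Monotone
  monotone_right : J.Monotone

/-- The modal disjunctive interpolation property. -/
def HasMDIP {α : Type*} (L : Set (Formula α)) : Prop :=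
  ∀ φ ψ θ : Formula α, φ.imp (ψ.box.or θ.box) ∈ L → ∃ I J : Formula α, IsMDI L φ ψ θ I J

/-- The monotone modal disjunctive interpolation property. -/
def HasMonotoneMDIP {α : Type*} (L : Set (Formula α)) : Prop :=
  ∀ φ ψ θ : Formula α, φ.Monotone → φ.imp (ψ.box.or θ.box) ∈ L →
    ∃ I J : Formula α, IsMonotoneMDI L φ ψ θ I J

end ModalDI

namespace ModalDI

/-! No cut elimination is needed. Call a formula admissible if its atoms lie in `V(φ)` and, in the
monotone case, it is monotone. The formulas that split into admissible `I`, `J` form an ideal. If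
`φ` were outside it, `exists_prime_theory` would give a prime theory `T` containing `φ` and missing
the ideal. Form a virtual root: atoms are read off from `T`, and `□χ` holds when some admissible `D
∈ T` proves `□χ` (and, under `LS4`, `χ` holds too). Provable sequents are true at this root
(`RootTrue.sound`), while on admissible formulas truth is membership in `T`. So `φ` is true there,
hence `□ψ` or `□θ` is; its witness `D` lies in both `T` and the ideal, a contradiction. -/

variable {α : Type*} {R : Set ModalRule}

/-! ### Derived structural and propositional rules -/

namespace Provable

theorem perm_left {Γ Γ' Δ : List (Formula α)} (h : Γ.Perm Γ') :
    Provable R Γ Δ → Provable R Γ' Δ := by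
  suffices H : ∀ Ξ : List (Formula α), Provable R (Ξ ++ Γ) Δ → Provable R (Ξ ++ Γ') Δ from H []
  induction h with
  | nil => exact fun _ h => h
  | cons x _ ih =>
    intro Ξ h
    simpa using ih (Ξ ++ [x]) (by simpa using h)
  | swap x y l =>
    intro Ξ h
    simpa using exchL Ξ l Δ y x (by simpa using h)
  | trans _ _ ih₁ ih₂ => exact fun Ξ h => ih₂ Ξ (ih₁ Ξ h)

theorem perm_right {Γ Δ Δ' : List (Formula α)} (h : Δ.Perm Δ') :
    Provable R Γ Δ → Provable R Γ Δ' := by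
  suffices H : ∀ Ξ : List (Formula α), Provable R Γ (Ξ ++ Δ) → Provable R Γ (Ξ ++ Δ') from H []
  induction h with
  | nil => exact fun _ h => h
  | cons x _ ih =>
    intro Ξ h
    simpa using ih (Ξ ++ [x]) (by simpa using h)
  | swap x y l =>
    intro Ξ h
    simpa using exchR Γ Ξ l y x (by simpa using h)
  | trans _ _ ih₁ ih₂ => exact fun Ξ h => ih₂ Ξ (ih₁ Ξ h)

theorem contract_left {Γ Δ : List (Formula α)} {γ : Formula α} (hγ : γ ∈ Γ)
    (h : Provable R (γ :: Γ) Δ) : Provable R Γ Δ := by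
  obtain ⟨s, t, rfl⟩ := List.append_of_mem hγ
  have hp : (s ++ γ :: t).Perm (s ++ t ++ [γ]) := by
    simpa using List.perm_middle.trans (List.perm_append_singleton γ (s ++ t)).symm
  refine perm_left hp.symm (contrL _ _ _ (perm_left ?_ h))
  simpa using (List.Perm.cons γ hp).trans (List.perm_append_singleton γ (s ++ t ++ [γ])).symm

theorem contract_right {Γ Δ : List (Formula α)} {δ : Formula α} (hδ : δ ∈ Δ)
    (h : Provable R Γ (δ :: Δ)) : Provable R Γ Δ := by
  obtain ⟨s, t, rfl⟩ := List.append_of_mem hδ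
  exact perm_right List.perm_middle.symm
    (contrR _ _ _ (perm_right (List.Perm.cons δ List.perm_middle) h))

theorem mono_left {Γ Γ' Δ : List (Formula α)} (hs : Γ ⊆ Γ') (h : Provable R Γ Δ) :
    Provable R Γ' Δ := by
  have hw : ∀ Ξ : List (Formula α), Provable R (Γ ++ Ξ) Δ := by
    intro Ξ
    induction Ξ with
    | nil => simpa using h
    | cons x Ξ ih =>
      refine perm_left ?_ (weakL _ _ x ih)
      exact (List.perm_append_singleton x (Γ ++ Ξ)).trans List.perm_middle.symm
  have hc : ∀ Ξ : List (Formula α), Ξ ⊆ Γ' → Provable R (Ξ ++ Γ') Δ → Provable R Γ' Δ := by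
    intro Ξ
    induction Ξ with
    | nil => exact fun _ h => h
    | cons x Ξ ih =>
      intro hx h
      rw [List.cons_subset] at hx
      exact ih hx.2 (contract_left (List.mem_append_right _ hx.1) h)
  exact hc Γ hs (hw Γ')

theorem mono_right {Γ Δ Δ' : List (Formula α)} (hs : Δ ⊆ Δ') (h : Provable R Γ Δ) :
    Provable R Γ Δ' := by
  have hw : ∀ Ξ : List (Formula α), Provable R Γ (Ξ ++ Δ) := by
    intro Ξ
    induction Ξ with
    | nil => exact h
    | cons x Ξ ih => exact weakR _ _ x ih
  have hc : ∀ Ξ : List (Formula α), Ξ ⊆ Δ' → Provable R Γ (Ξ ++ Δ') → Provable R Γ Δ' := by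
    intro Ξ
    induction Ξ with
    | nil => exact fun _ h => h
    | cons x Ξ ih =>
      intro hx h
      rw [List.cons_subset] at hx
      exact ih hx.2 (contract_right (List.mem_append_right _ hx.1) h)
  exact hc Δ hs (perm_right List.perm_append_comm (hw Δ'))

theorem cut_list {Ξ Γ Δ : List (Formula α)} (hΓ : ∀ γ ∈ Γ, Provable R Ξ [γ])
    (h : Provable R (Γ ++ Ξ) Δ) : Provable R Ξ Δ := by
  induction Γ with
  | nil => exact h
  | cons γ Γ ih =>
    refine ih (fun x hx => hΓ x (List.mem_cons_of_mem _ hx)) (cut _ _ γ ?_ ?_)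
    · exact mono_left (by simp) (mono_right (by simp) (hΓ γ (by simp)))
    · exact perm_left (List.perm_append_singleton γ (Γ ++ Ξ)).symm h

theorem cut_all {Ξ Γ Δ : List (Formula α)} (hΓ : ∀ γ ∈ Γ, Provable R Ξ [γ])
    (h : Provable R Γ Δ) : Provable R Ξ Δ :=
  cut_list hΓ (mono_left (by simp) h)

theorem of_mem {Γ Δ : List (Formula α)} {φ : Formula α} (h₁ : φ ∈ Γ) (h₂ : φ ∈ Δ) :
    Provable R Γ Δ :=
  mono_left (by simpa using h₁) (mono_right (by simpa using h₂) (ax φ))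

theorem trans {a b c : Formula α} (h₁ : Provable R [a] [b]) (h₂ : Provable R [b] [c]) :
    Provable R [a] [c] :=
  cut_all (by simpa using h₁) h₂

theorem and_left (a b : Formula α) : Provable R [a.and b] [a] := andL₁ [] _ _ _ (ax a)

theorem and_right (a b : Formula α) : Provable R [a.and b] [b] := andL₂ [] _ _ _ (ax b)

theorem or_inl (a b : Formula α) : Provable R [a] [a.or b] := orR₁ _ _ _ _ (ax a)

theorem or_inr (a b : Formula α) : Provable R [b] [a.or b] := orR₂ _ _ _ _ (ax b)

theorem or_elim {a b c : Formula α} (h₁ : Provable R [a] [c]) (h₂ : Provable R [b] [c]) :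
    Provable R [a.or b] [c] :=
  orL [] _ _ _ h₁ h₂

theorem and_intro {a b c : Formula α} (h₁ : Provable R [c] [a]) (h₂ : Provable R [c] [b]) :
    Provable R [c] [a.and b] :=
  andR _ _ _ _ h₁ h₂

theorem and_mono {a b c d : Formula α} (h₁ : Provable R [a] [c]) (h₂ : Provable R [b] [d]) :
    Provable R [a.and b] [c.and d] :=
  and_intro (trans (and_left a b) h₁) (trans (and_right a b) h₂)

theorem and_of_pair {a b c : Formula α} (h : Provable R [a, b] [c]) :
    Provable R [a.and b] [c] :=
  cut_all (by simpa using ⟨and_left a b, and_right a b⟩) h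

theorem pair_of_and {a b c : Formula α} (h : Provable R [a.and b] [c]) :
    Provable R [a, b] [c] := by
  have hab : Provable R [a, b] [a.and b] :=
    andR _ _ _ _ (of_mem (φ := a) (by simp) (by simp)) (of_mem (φ := b) (by simp) (by simp))
  exact cut_all (by simpa using hab) h

theorem and_or {t a b c : Formula α} (h₁ : Provable R [t.and a] [c])
    (h₂ : Provable R [t.and b] [c]) : Provable R [t.and (a.or b)] [c] :=
  and_of_pair (orL [t] _ _ _ (pair_of_and h₁) (pair_of_and h₂))

theorem modus_ponens (a b : Formula α) : Provable R [a, a.imp b] [b] :=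
  impL [a] [b] a b (of_mem (φ := a) (by simp) (by simp)) (of_mem (φ := b) (by simp) (by simp))

theorem or_imp (a b c : Formula α) : Provable R [c] [a.or (a.imp b)] := by
  have h : Provable R [c] [a.imp b, a] :=
    impR [c] [a] a b (of_mem (φ := a) (by simp) (by simp))
  have h' : Provable R [c] [a, a.or (a.imp b)] := perm_right (List.Perm.swap _ _ _) (orR₂ _ _ a _ h)
  exact contract_right (by simp) (orR₁ _ _ a (a.imp b) h')

theorem imp_of_right (a b : Formula α) : Provable R [b] [a.imp b] :=
  impR [b] [] a b (of_mem (φ := b) (by simp) (by simp))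

theorem imp_iff {a b : Formula α} : Provable R [] [a.imp b] ↔ Provable R [a] [b] := by
  refine ⟨fun h => cut_list (Γ := [a.imp b]) ?_ ?_, fun h => impR [] [] a b h⟩
  · simpa using mono_left (by simp) h
  · exact perm_left (List.Perm.swap _ _ _) (modus_ponens a b)

end Provable

/-! ### Theories and prime extension -/

/-- Deductively closed sets of formulas. -/
structure IsTheory (R : Set ModalRule) (T : Set (Formula α)) : Prop where
  top : Formula.top ∈ T
  and {a b : Formula α} : a ∈ T → b ∈ T → a.and b ∈ T
  up {a b : Formula α} : a ∈ T → Provable R [a] [b] → b ∈ T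

/-- The theory generated by adding a formula to a theory. -/
def adjoin (R : Set ModalRule) (T : Set (Formula α)) (a : Formula α) : Set (Formula α) :=
  {χ | ∃ t ∈ T, Provable R [t.and a] [χ]}

theorem IsTheory.adjoin {T : Set (Formula α)} (hT : IsTheory R T) (a : Formula α) :
    IsTheory R (adjoin R T a) where
  top := ⟨_, hT.top, Provable.and_left _ _⟩
  and := by
    rintro x y ⟨s, hs, hx⟩ ⟨t, ht, hy⟩
    exact ⟨_, hT.and hs ht, Provable.and_intro
      ((Provable.and_mono (Provable.and_left s t) (.ax a)).trans hx)
      ((Provable.and_mono (Provable.and_right s t) (.ax a)).trans hy)⟩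
  up := fun ⟨t, ht, hx⟩ h => ⟨t, ht, hx.trans h⟩

theorem IsTheory.subset_adjoin (T : Set (Formula α)) (a : Formula α) :
    T ⊆ ModalDI.adjoin R T a :=
  fun t ht => ⟨t, ht, Provable.and_left _ _⟩

theorem IsTheory.mem_adjoin {T : Set (Formula α)} (hT : IsTheory R T) (a : Formula α) :
    a ∈ ModalDI.adjoin R T a :=
  ⟨_, hT.top, Provable.and_right _ _⟩

theorem isTheory_principal (φ : Formula α) : IsTheory R {χ | Provable R [φ] [χ]} where
  top := Provable.mono_left (by simp) .topR
  and := Provable.and_intro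
  up := Provable.trans

/-- A formula outside an ideal lies in a prime theory disjoint from that ideal. -/
theorem exists_prime_theory {N : Set (Formula α)}
    (hdown : ∀ a b : Formula α, Provable R [a] [b] → b ∈ N → a ∈ N)
    (hor : ∀ a b : Formula α, a ∈ N → b ∈ N → a.or b ∈ N) {φ : Formula α} (hφ : φ ∉ N) :
    ∃ T : Set (Formula α), IsTheory R T ∧ φ ∈ T ∧ (∀ a ∈ T, a ∉ N) ∧
      ∀ a b : Formula α, a.or b ∈ T → a ∈ T ∨ b ∈ T := by
  obtain ⟨T, hφT, hmax⟩ := zorn_subset_nonempty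
    {T : Set (Formula α) | IsTheory R T ∧ ∀ a ∈ T, a ∉ N} (by
      intro c hc hchain hne
      refine ⟨⋃₀ c, ⟨⟨?_, ?_, ?_⟩, ?_⟩, fun s hs => Set.subset_sUnion_of_mem hs⟩
      · obtain ⟨s, hs⟩ := hne
        exact ⟨s, hs, (hc hs).1.top⟩
      · rintro a b ⟨s, hs, ha⟩ ⟨t, ht, hb⟩
        rcases hchain.total hs ht with h | h
        · exact ⟨t, ht, (hc ht).1.and (h ha) hb⟩
        · exact ⟨s, hs, (hc hs).1.and ha (h hb)⟩
      · rintro a b ⟨s, hs, ha⟩ h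
        exact ⟨s, hs, (hc hs).1.up ha h⟩
      · rintro a ⟨s, hs, ha⟩
        exact (hc hs).2 a ha)
    {χ | Provable R [φ] [χ]}
    ⟨isTheory_principal φ, fun a ha haN => hφ (hdown φ a ha haN)⟩
  obtain ⟨hT, hN⟩ := hmax.prop
  -- By maximality, adjoining a missing formula must make the theory meet `N`.
  have key : ∀ a, a ∉ T → ∃ t ∈ T, t.and a ∈ N := by
    intro a ha
    by_contra! hcon
    have hmem : ModalDI.adjoin R T a ∈
        {T : Set (Formula α) | IsTheory R T ∧ ∀ a ∈ T, a ∉ N} :=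
      ⟨hT.adjoin a, fun x ⟨t, ht, hx⟩ hxN => hcon t ht (hdown _ _ hx hxN)⟩
    exact ha (hmax.le_of_ge hmem (IsTheory.subset_adjoin T a) (hT.mem_adjoin a))
  refine ⟨T, hT, hφT (.ax φ), hN, fun a b hab => ?_⟩
  by_contra! hcon
  obtain ⟨s, hs, hsN⟩ := key a hcon.1
  obtain ⟨t, ht, htN⟩ := key b hcon.2
  refine hN _ (hT.and (hT.and hs ht) hab) (hdown _ _ ?_ (hor _ _ hsN htN))
  exact Provable.and_or
    ((Provable.and_mono (Provable.and_left s t) (.ax a)).trans (Provable.or_inl _ _))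
    ((Provable.and_mono (Provable.and_right s t) (.ax b)).trans (Provable.or_inr _ _))

/-! ### The virtual root -/

/-- The valuation at a virtual root: atoms are read off from `v`, and `□φ` is true if `P φ`
holds and, for a reflexive logic, `φ` is true as well. -/
def RootTrue (R : Set ModalRule) (v : α → Prop) (P : Formula α → Prop) : Formula α → Prop
  | .atom p => v p
  | .top => True
  | .bot => False
  | .and φ ψ => RootTrue R v P φ ∧ RootTrue R v P ψ
  | .or φ ψ => RootTrue R v P φ ∨ RootTrue R v P ψ
  | .imp φ ψ => RootTrue R v P φ → RootTrue R v P ψ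
  | .box φ => P φ ∧ (ModalRule.LS4 ∈ R → RootTrue R v P φ)

/-- Connectives are evaluated classically, so cut and the other `LK` rules are immediate. For a rule
introducing a box on the right, `hP` is applied to its provable conclusion; the induction hypothesis
serves only the reflexive conjunct. `hbot` covers an empty succedent in `D` and `KD4`. -/
theorem RootTrue.sound (hR : ModalRule.LS4 ∈ R → ModalRule.GL ∉ R) {v : α → Prop}
    {P : Formula α → Prop}
    (hP : ∀ (Γ : List (Formula α)) (φ : Formula α), (∀ γ ∈ Γ, P γ) →
      Provable R (boxes Γ) [φ.box] → P φ)
    (hbot : ∀ Γ : List (Formula α), (∀ γ ∈ Γ, P γ) → ¬ Provable R (boxes Γ) [])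
    {Γ Δ : List (Formula α)} (h : Provable R Γ Δ) (hΓ : ∀ γ ∈ Γ, RootTrue R v P γ) :
    ∃ δ ∈ Δ, RootTrue R v P δ := by
  have hbox : ∀ {Γ : List (Formula α)}, (∀ γ ∈ boxes Γ, RootTrue R v P γ) →
      (∀ γ ∈ Γ, P γ) ∧ (ModalRule.LS4 ∈ R → ∀ γ ∈ Γ, RootTrue R v P γ) := by
    intro Γ h
    have h' : ∀ γ ∈ Γ, RootTrue R v P γ.box := fun γ hγ => h _ (List.mem_map_of_mem hγ)
    exact ⟨fun γ hγ => (h' γ hγ).1, fun hr γ hγ => (h' γ hγ).2 hr⟩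
  induction h with
  | ruleK Γ φ hr h ih =>
    obtain ⟨h₁, h₂⟩ := hbox hΓ
    exact ⟨φ.box, by simp, hP Γ φ h₁ (.ruleK Γ φ hr h), fun hl => by simpa using ih (h₂ hl)⟩
  | ruleD Γ Δ hr hl h ih =>
    obtain ⟨h₁, h₂⟩ := hbox hΓ
    match Δ, hl, h, ih with
    | [], hl, h, _ => exact absurd (Provable.ruleD Γ [] hr hl h) (hbot Γ h₁)
    | [δ], hl, h, ih =>
      exact ⟨δ.box, by simp [boxes], hP Γ δ h₁ (.ruleD Γ [δ] hr hl h),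
        fun hl => by simpa using ih (h₂ hl)⟩
  | ruleK4 Γ φ hr h ih =>
    obtain ⟨h₁, h₂⟩ := hbox hΓ
    refine ⟨φ.box, by simp, hP Γ φ h₁ (.ruleK4 Γ φ hr h), fun hl => ?_⟩
    simpa using ih fun γ hγ => (List.mem_append.1 hγ).elim (hΓ γ) (h₂ hl γ)
  | ruleKD4 Γ Δ hr hl h ih =>
    obtain ⟨h₁, h₂⟩ := hbox hΓ
    match Δ, hl, h, ih with
    | [], hl, h, _ => exact absurd (Provable.ruleKD4 Γ [] hr hl h) (hbot Γ h₁)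
    | [δ], hl, h, ih =>
      refine ⟨δ.box, by simp [boxes], hP Γ δ h₁ (.ruleKD4 Γ [δ] hr hl h), fun hl => ?_⟩
      simpa using ih fun γ hγ => (List.mem_append.1 hγ).elim (hΓ γ) (h₂ hl γ)
  | ruleLS4 Γ Δ φ hr h ih =>
    refine ih fun γ hγ => ?_
    rcases List.mem_append.1 hγ with hγ | hγ
    · exact hΓ γ (by simp [hγ])
    · rw [List.mem_singleton.1 hγ]
      exact (hΓ φ.box (by simp)).2 hr
  | ruleRS4 Γ φ hr h ih =>
    exact ⟨φ.box, by simp, hP Γ φ (hbox hΓ).1 (.ruleRS4 Γ φ hr h), fun _ => by simpa using ih hΓ⟩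
  | ruleGL Γ φ hr h ih =>
    -- The induction hypothesis would need `□φ` itself to be true, so reflexivity is excluded here.
    exact ⟨φ.box, by simp, hP Γ φ (hbox hΓ).1 (.ruleGL Γ φ hr h), fun hl => absurd hr (hR hl)⟩
  | _ =>
    simp only [List.mem_append, List.mem_cons, List.not_mem_nil, or_false, or_imp, forall_and,
      forall_eq, exists_eq_or_imp, exists_eq_left, RootTrue] at * <;>
    grind

/-! ### Extraction of the interpolants -/

/-- The switch `m` treats both properties at once: `False` gives the plain one, `True` the monotone
one. -/
theorem exists_interpolants (hR : ModalRule.LS4 ∈ R → ModalRule.GL ∉ R) (m : Prop)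
    {φ ψ θ : Formula α} (hm : m → φ.Monotone)
    (h : Provable R [φ] [ψ.box.or θ.box]) :
    ∃ I J : Formula α, (I.vars ⊆ φ.vars ∧ (m → I.Monotone)) ∧
      (J.vars ⊆ φ.vars ∧ (m → J.Monotone)) ∧ Provable R [φ] [I.or J] ∧
      Provable R [I] [ψ.box] ∧ Provable R [J] [θ.box] := by
  set C : Formula α → Prop := fun A => A.vars ⊆ φ.vars ∧ (m → A.Monotone) with hC
  have C_and : ∀ {a b : Formula α}, C a → C b → C (a.and b) := fun ha hb =>
    ⟨Set.union_subset ha.1 hb.1, fun hm => ⟨ha.2 hm, hb.2 hm⟩⟩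
  have C_or : ∀ {a b : Formula α}, C a → C b → C (a.or b) := fun ha hb =>
    ⟨Set.union_subset ha.1 hb.1, fun hm => ⟨ha.2 hm, hb.2 hm⟩⟩
  have C_top : C .top := ⟨Set.empty_subset _, fun _ => trivial⟩
  have C_bot : C .bot := ⟨Set.empty_subset _, fun _ => trivial⟩
  have bot_le : ∀ a : Formula α, Provable R [.bot] [a] := fun a =>
    Provable.mono_right (by simp) .botL
  by_contra hcon
  obtain ⟨T, hT, hφT, hN, hprime⟩ := exists_prime_theory (R := R) (φ := φ)
    (N := {χ | ∃ I J : Formula α, C I ∧ C J ∧ Provable R [χ] [I.or J] ∧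
      Provable R [I] [ψ.box] ∧ Provable R [J] [θ.box]})
    (fun a b hab ⟨I, J, hI, hJ, hb, h₁, h₂⟩ => ⟨I, J, hI, hJ, hab.trans hb, h₁, h₂⟩)
    (by
      rintro a b ⟨I, J, hI, hJ, ha, h₁, h₂⟩ ⟨I', J', hI', hJ', hb, h₁', h₂'⟩
      refine ⟨I.or I', J.or J', C_or hI hI', C_or hJ hJ', ?_, h₁.or_elim h₁', h₂.or_elim h₂'⟩
      refine (ha.trans ?_).or_elim (hb.trans ?_)
      · exact ((Provable.or_inl I I').trans (Provable.or_inl _ _)).or_elim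
          ((Provable.or_inl J J').trans (Provable.or_inr _ _))
      · exact ((Provable.or_inr I I').trans (Provable.or_inl _ _)).or_elim
          ((Provable.or_inr J J').trans (Provable.or_inr _ _)))
    hcon
  -- Such a `D` would be in the ideal, with `⊥` as the other interpolant.
  have hψ : ∀ D ∈ T, C D → ¬ Provable R [D] [ψ.box] := fun D hD hCD hp =>
    hN D hD ⟨D, .bot, hCD, C_bot, Provable.or_inl _ _, hp, bot_le _⟩
  have hθ : ∀ D ∈ T, C D → ¬ Provable R [D] [θ.box] := fun D hD hCD hp =>
    hN D hD ⟨.bot, D, C_bot, hCD, Provable.or_inr _ _, bot_le _, hp⟩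
  have hbotT : Formula.bot ∉ T := fun hb => hψ _ hb C_bot (bot_le _)
  set P : Formula α → Prop := fun χ => ∃ D ∈ T, C D ∧ Provable R [D] [χ.box] with hPdef
  -- Admissible formulas are closed under `∧`, so finitely many boxes share one witness.
  have hPlist : ∀ Γ : List (Formula α), (∀ γ ∈ Γ, P γ) →
      ∃ D ∈ T, C D ∧ ∀ γ ∈ boxes Γ, Provable R [D] [γ] := by
    intro Γ
    induction Γ with
    | nil => exact fun _ => ⟨.top, hT.top, C_top, by simp [boxes]⟩
    | cons γ Γ ih =>
      intro hΓ
      obtain ⟨D, hD, hCD, hγ⟩ := hΓ γ (by simp)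
      obtain ⟨E, hE, hCE, hE'⟩ := ih fun x hx => hΓ x (List.mem_cons_of_mem _ hx)
      refine ⟨D.and E, hT.and hD hE, C_and hCD hCE, fun x hx => ?_⟩
      rcases List.mem_cons.1 hx with rfl | hx
      · exact (Provable.and_left _ _).trans hγ
      · exact (Provable.and_right _ _).trans (hE' x hx)
  have truth : ∀ A : Formula α, C A →
      (A ∈ T ↔ RootTrue R (fun p => Formula.atom p ∈ T) P A) := by
    intro A
    induction A with
    | atom p => exact fun _ => Iff.rfl
    | top => exact fun _ => iff_of_true hT.top trivial
    | bot => exact fun _ => iff_of_false hbotT id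
    | and a b iha ihb =>
      rintro ⟨hv, hmono⟩
      have ha := iha ⟨Set.subset_union_left.trans hv, fun hm => (hmono hm).1⟩
      have hb := ihb ⟨Set.subset_union_right.trans hv, fun hm => (hmono hm).2⟩
      refine Iff.trans ?_ (and_congr ha hb)
      exact ⟨fun h => ⟨hT.up h (Provable.and_left _ _), hT.up h (Provable.and_right _ _)⟩,
        fun h => hT.and h.1 h.2⟩
    | or a b iha ihb =>
      rintro ⟨hv, hmono⟩
      have ha := iha ⟨Set.subset_union_left.trans hv, fun hm => (hmono hm).1⟩
      have hb := ihb ⟨Set.subset_union_right.trans hv, fun hm => (hmono hm).2⟩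
      refine Iff.trans ?_ (or_congr ha hb)
      exact ⟨hprime a b, fun h => h.elim (fun h => hT.up h (Provable.or_inl _ _))
        fun h => hT.up h (Provable.or_inr _ _)⟩
    | imp a b iha ihb =>
      rintro ⟨hv, hmono⟩
      -- An admissible implication occurs only in the plain case, so its subformulas need only the
      -- condition on atoms.
      have hm' : ¬ m := fun hm => hmono hm
      have ha := iha ⟨Set.subset_union_left.trans hv, fun hm => absurd hm hm'⟩
      have hb := ihb ⟨Set.subset_union_right.trans hv, fun hm => absurd hm hm'⟩
      refine Iff.trans ?_ (imp_congr ha hb)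
      refine ⟨fun h h' => hT.up (hT.and h' h) (Provable.modus_ponens a b).and_of_pair, fun h => ?_⟩
      -- Primality is applied to the classical theorem `a ∨ (a → b)`.
      rcases hprime _ _ (hT.up hT.top (Provable.or_imp a b .top)) with h' | h'
      · exact hT.up (h h') (Provable.imp_of_right a b)
      · exact h'
    | box a iha =>
      intro hCa
      -- Since `□a` is admissible, it serves as its own witness.
      refine ⟨fun h => ⟨⟨_, h, hCa, .ax _⟩, fun hl => ?_⟩, fun h => ?_⟩
      · exact (iha hCa).1 (hT.up h (Provable.ruleLS4 [] [a] a hl (.ax a)))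
      · obtain ⟨⟨D, hD, -, hDa⟩, -⟩ := h
        exact hT.up hD hDa
  have hroot := RootTrue.sound (v := fun p => Formula.atom p ∈ T) hR (P := P)
    (fun Γ χ hΓ hp => by
      obtain ⟨D, hD, hCD, hD'⟩ := hPlist Γ hΓ
      exact ⟨D, hD, hCD, Provable.cut_all hD' hp⟩)
    (fun Γ hΓ hp => by
      obtain ⟨D, hD, hCD, hD'⟩ := hPlist Γ hΓ
      exact hbotT (hT.up hD (Provable.weakR _ _ _ (Provable.cut_all hD' hp))))
    h (by simpa using (truth φ ⟨subset_rfl, hm⟩).1 hφT)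
  simp only [List.mem_singleton, exists_eq_left] at hroot
  rcases hroot with ⟨⟨D, hD, hCD, hp⟩, -⟩ | ⟨⟨D, hD, hCD, hp⟩, -⟩
  · exact hψ D hD hCD hp
  · exact hθ D hD hCD hp

theorem Calculus.gl_notMem_rules_of_ls4 (G : Calculus) :
    ModalRule.LS4 ∈ G.rules → ModalRule.GL ∉ G.rules := by
  cases G <;> simp [Calculus.rules]

end ModalDI

theorem mainTheorem6 (α : Type*) (G : ModalDI.Calculus) :
    ModalDI.HasMDIP (G.logic α) ∧ ModalDI.HasMonotoneMDIP (G.logic α) := by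
  refine ⟨fun φ ψ θ h => ?_, fun φ ψ θ hφ h => ?_⟩
  · obtain ⟨I, J, hI, hJ, h₁, h₂, h₃⟩ := ModalDI.exists_interpolants
      G.gl_notMem_rules_of_ls4 False False.elim (ModalDI.Provable.imp_iff.1 h)
    exact ⟨I, J, hI.1, hJ.1, ModalDI.Provable.imp_iff.2 h₁, ModalDI.Provable.imp_iff.2 h₂,
      ModalDI.Provable.imp_iff.2 h₃⟩
  · obtain ⟨I, J, hI, hJ, h₁, h₂, h₃⟩ := ModalDI.exists_interpolants
      G.gl_notMem_rules_of_ls4 True (fun _ => hφ) (ModalDI.Provable.imp_iff.1 h)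
    exact ⟨I, J, ⟨hI.1, hJ.1, ModalDI.Provable.imp_iff.2 h₁, ModalDI.Provable.imp_iff.2 h₂,
      ModalDI.Provable.imp_iff.2 h₃⟩, hφ, hI.2 trivial, hJ.2 trivial⟩
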